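/- **Theorem 3.1.** A *network* $\mathcal N$ consists of a finite directed acyclic multigraph with node set $\mathcal V$ and edge set $\mathcal E$, distinct source nodes $\sigma_1,\dots,\sigma_s\in\mathcal V$, and a receiver $\rho\in\mathcal V$ that is not a source, such that every node has a directed path to $\rho$ and every node without in-edges is a source (so $s\ge 1$). Let $\mathcal A$ be a finite alphabet with $|\mathcal A|\ge 2$, and let $f:\mathcal A^s\to\mathcal A^s$, $f(x_1,\dots,x_s)=(x_1,\dots,x_s)$, be the identity target function. For positive integers $k,n$, a *$(k,n)$ network code* assigns to every edge $e$, with tail $v$, an encoding function that maps the vectors in $\mathcal A^n$ carried by the in-edges of $v$, together with the message vector in $\mathcal A^k$ of $v$ if $v$ is a source, to the vector in $\mathcal A^n$ carried by $e$; and it has a decoding function that maps the vectors carried by the in-edges of $\rho$ to an element of $(\mathcal A^s)^k$. It is a *solution* for $f$ if, for all message vectors $\alpha(\sigma_1),\dots,\alpha(\sigma_s)\in\mathcal A^k$ and every $j\in\{1,\dots,k\}$, the $j$-th component of the decoded vector is $f(\alpha(\sigma_1)_j,\dots,\alpha(\sigma_s)_j)$. The *computing capacity* is $$\mathcal C_{\rm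 cod}(\mathcal N,f)=\sup\{k/n : \text{there is a } (k,n) \text{ network code that is a solution for } f\}.$$ For $C\subseteq\mathcal E$ let $I_C$ be the set of $i$ such that every directed path from $\sigma_i$ to $\rho$ contains an edge of $C$; $C$ is a *cut* if $I_C\neq\emptyset$. Let $R_{C,f}$ be the number of classes of the equivalence relation on $\mathcal A^{I_C}$ under which $a\equiv b$ if and only if $f(x)=f(y)$ for all $x,y\in\mathcal A^s$ that restrict to $a$ and $b$ respectively on $I_C$ and agree outside $I_C$. Then $$\mathcal C_{\rm cod}(\mathcal N,f)=\min_{C\text{ a cut}}\frac{|C|}{\log_{|\mathcal A|}R_{C,f}}=\min_{C\text{ a cut}}\frac{|C|}{|I_C|},$$ where the supremum is that of a non-empty bounded set and both minima are attained. The first minimum is $\text{min-cut}(\mathcal N,f)$ and the second is $\text{min-cut}(\mathcal N)$. -/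

import Mathlib

namespace NetComp

/-- A directed multigraph with vertex set `V` and edge set `E`: every edge has a tail and a head,
and parallel edges are allowed. -/
structure DiMultigraph (V E : Type*) where
  tail : E → V
  head : E → V

namespace DiMultigraph

variable {V E : Type*} (G : DiMultigraph V E)

/-- `G.IsPath u p v`: the list of edges `p` is a directed path from `u` to `v`, each edge starting
where the previous one ends. (In an acyclic graph, which is the only case used, no such list can
repeat a vertex.) -/
def IsPath : V → List E → V → Prop
  | u, [], v => u = v
  | u, e :: p, v => G.tail e = u ∧ IsPath (G.head e) p v

/-- There is no directed cycle: the only closed directed path is the one without edges. -/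
def IsAcyclic : Prop := ∀ (v : V) (p : List E), G.IsPath v p v → p = []

/-- The in-edges of `v`. -/
abbrev InEdge (v : V) : Type _ := {e : E // G.head e = v}

/-- In a finite acyclic multigraph the relation `the edge e' ends where the edge e starts` is
well-founded. -/
theorem IsAcyclic.wellFounded [Finite E] {G : DiMultigraph V E} (h : G.IsAcyclic) :
    WellFounded (fun e' e : E => G.head e' = G.tail e) := by
  have key : ∀ a b : E, Relation.TransGen (fun e' e : E => G.head e' = G.tail e) a b →
      ∃ p : List E, p ≠ [] ∧ G.IsPath (G.tail a) p (G.tail b) := by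
    intro a b hab
    induction hab using Relation.TransGen.head_induction_on with
    | single hab => exact ⟨[_], by simp, rfl, hab⟩
    | head hac _ ih =>
      obtain ⟨p, _, hp⟩ := ih
      refine ⟨_ :: p, by simp, rfl, ?_⟩
      rw [hac]
      exact hp
  have hirr : Std.Irrefl (Relation.TransGen (fun e' e : E => G.head e' = G.tail e)) := by
    refine ⟨fun a ha => ?_⟩
    obtain ⟨p, hne, hp⟩ := key a a ha
    exact hne (h _ p hp)
  have hwf : WellFounded (Relation.TransGen (fun e' e : E => G.head e' = G.tail e)) :=
    Finite.wellFounded_of_trans_of_irrefl _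
  exact Subrelation.wf (r := Relation.TransGen (fun e' e : E => G.head e' = G.tail e))
    (fun hab => Relation.TransGen.single hab) hwf

end DiMultigraph

/-- A single-receiver network with sources `source 0, …, source (s - 1)` (pairwise distinct nodes).
Finiteness of `V` and `E` is imposed through instance arguments where networks are used. -/
structure Network (V E : Type*) (s : ℕ) where
  graph : DiMultigraph V E
  source : Fin s ↪ V
  receiver : V
  acyclic : graph.IsAcyclic
  receiver_not_source : ∀ i, source i ≠ receiver
  path_to_receiver : ∀ v : V, ∃ p : List E, graph.IsPath v p receiver
  source_of_no_inEdge : ∀ v : V, (∀ e : E, graph.head e ≠ v) → ∃ i, source i = v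

/-- A `(k, n)` network code with alphabet `A` and values in `B`.

The index type `{i // N.source i = v}` has exactly one element if `v` is a source node and is empty
otherwise, as the sources are distinct. Hence the encoding function of an edge `e` out of a source
node takes the vectors on the in-edges of that node and its message vector in `A^k`, and the
encoding function of any other edge takes only the vectors on the in-edges. The receiver has no
out-edges, since the graph is acyclic and every node has a path to the receiver. -/
structure Code {V E : Type*} {s : ℕ} (N : Network V E s) (A B : Type*) (k n : ℕ) where
  encode : ∀ e : E, (N.graph.InEdge (N.graph.tail e) → Fin n → A) →
    ({i : Fin s // N.source i = N.graph.tail e} → Fin k → A) → Fin n → A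
  decode : (N.graph.InEdge N.receiver → Fin n → A) → Fin k → B

namespace Code

variable {V E : Type*} [Finite E] {s : ℕ} {N : Network V E s} {A B : Type*} {k n : ℕ}

/-- The vector carried by each edge when the message generator is `α`, obtained by evaluating the
encoding functions along the acyclic graph. -/
noncomputable def carried (c : Code N A B k n) (α : Fin s → Fin k → A) : E → Fin n → A :=
  N.acyclic.wellFounded.fix fun e z =>
    c.encode e (fun e' => z e'.1 e'.2) (fun i => α i.1)

theorem carried_eq (c : Code N A B k n) (α : Fin s → Fin k → A) (e : E) :
    c.carried α e = c.encode e (fun e' => c.carried α e'.1) (fun i => α i.1) :=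
  WellFounded.fix_eq _ _ _

/-- The code computes `f`: for every message generator and each component `j`, the receiver
recovers the value of `f` at the `j`-th messages of the sources. -/
def IsSolution (c : Code N A B k n) (f : (Fin s → A) → B) : Prop :=
  ∀ (α : Fin s → Fin k → A) (j : Fin k),
    c.decode (fun e => c.carried α e.1) j = f (fun i => α i j)

end Code

/-- Two assignments of the arguments indexed by `I` are equivalent if they are interchangeable in
`f`, for any values of the remaining arguments. -/
def footprintSetoid {s : ℕ} {A B : Type*} (f : (Fin s → A) → B) (I : Set (Fin s)) :
    Setoid (I → A) where
  r a b := ∀ x y : Fin s → A, (∀ i : I, x i = a i) → (∀ i : I, y i = b i) →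
    (∀ j, j ∉ I → x j = y j) → f x = f y
  iseqv :=
    { refl := fun a x y hx hy hxy => by
        congr 1
        funext j
        by_cases hj : j ∈ I
        · rw [hx ⟨j, hj⟩, hy ⟨j, hj⟩]
        · exact hxy j hj
      symm := fun h x y hx hy hxy => (h y x hy hx fun j hj => (hxy j hj).symm).symm
      trans := fun {a b c} hab hbc x z hx hz hxz => by
        classical
        let y : Fin s → A := fun j => if hj : j ∈ I then b ⟨j, hj⟩ else x j
        have hy : ∀ i : I, y i = b i := fun i => dif_pos i.2
        have hyx : ∀ j, j ∉ I → y j = x j := fun j hj => dif_neg hj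
        exact (hab x y hx hy fun j hj => (hyx j hj).symm).trans
          (hbc y z hy hz fun j hj => (hyx j hj).trans (hxz j hj)) }

/-- The footprint size of `f` with respect to `I`: the number of equivalence classes. -/
noncomputable def footprintSize {s : ℕ} {A B : Type*} (f : (Fin s → A) → B)
    (I : Set (Fin s)) : ℕ :=
  Nat.card (Quotient (footprintSetoid f I))

/-- The identity target function with `s` arguments over the alphabet `A`. -/
def identityTarget (A : Type*) (s : ℕ) : (Fin s → A) → (Fin s → A) := fun x => x

namespace Network

variable {V E : Type*} {s : ℕ} (N : Network V E s)

/-- The edge set `C` separates the `i`-th source from the receiver. -/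
def Separates (C : Finset E) (i : Fin s) : Prop :=
  ∀ p : List E, N.graph.IsPath (N.source i) p N.receiver → ∃ e ∈ p, e ∈ C

/-- The set of indices of the sources which `C` separates from the receiver. -/
def separated (C : Finset E) : Set (Fin s) := {i | N.Separates C i}

/-- `C` is a cut: it separates at least one source from the receiver. -/
def IsCut (C : Finset E) : Prop := (N.separated C).Nonempty

/-- The achievable computing rates `k / n`, with `k` and `n` positive. -/
def achievableRates [Finite E] {A B : Type*} (f : (Fin s → A) → B) : Set ℝ :=
  {r | ∃ k n : ℕ, 0 < k ∧ 0 < n ∧ r = (k : ℝ) / (n : ℝ) ∧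
    ∃ c : Code N A B k n, c.IsSolution f}

/-- The computing capacity of the network with respect to the target function `f`. -/
noncomputable def computingCapacity [Finite E] {A B : Type*} (f : (Fin s → A) → B) : ℝ :=
  sSup (N.achievableRates f)

/-- The values `|C| / log_{|A|} R_{C,f}` over all cuts `C`. -/
def targetCutRatios {A B : Type*} (f : (Fin s → A) → B) : Set ℝ :=
  {r | ∃ C : Finset E, N.IsCut C ∧
    r = (C.card : ℝ) / Real.logb (Nat.card A) (footprintSize f (N.separated C))}

/-- The min-cut of the network with respect to the target function `f`. -/
noncomputable def targetMinCut {A B : Type*} (f : (Fin s → A) → B) : ℝ :=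
  sInf (N.targetCutRatios f)

/-- The values `|C| / |I_C|` over all cuts `C`. -/
def cutRatios : Set ℝ :=
  {r | ∃ C : Finset E, N.IsCut C ∧ r = (C.card : ℝ) / ((N.separated C).ncard : ℝ)}

/-- The min-cut of the network, with unit edge capacities. -/
noncomputable def minCut : ℝ := sInf N.cutRatios

end Network

end NetComp

/-! Both bounds come from cuts. Upper bound: given the messages of the unseparated sources, the
vectors carried on a cut `C` determine what the receiver decodes, so the `|A|^(k|I_C|)` choices of
separated messages inject into the `|A|^(n|C|)` values on `C` (`carried_congr_of_cut`,
`mul_ncard_separated_le`). Lower bound: routing suffices. For a cut `C` of least ratio take `k =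
|C|` and `n = |I_C|`. Minimality is exactly the Menger condition for `k` paths from each source in
the graph with `n` copies of each edge (`exists_disjoint_paths`, `exists_routing`), and
edge-disjoint paths make a code (`exists_solution_of_routing`). So the supremum is attained. For the
identity no two assignments are equivalent, hence `R_{C,f} = |A|^|I_C|` and the two families of
ratios coincide. -/

namespace NetComp

open Finset

/-! ### Edge-disjoint directed paths. -/

namespace DiMultigraph

variable {V E T : Type*} {G : DiMultigraph V E}

/-- An edge of a directed path starts at the initial vertex or where another edge of the path
ends. -/
theorem IsPath.tail_eq_or_exists_head_eq {u v : V} {p : List E} (hp : G.IsPath u p v) {e : E}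
    (he : e ∈ p) : G.tail e = u ∨ ∃ x ∈ p, G.head x = G.tail e := by
  induction p generalizing u with
  | nil => simp at he
  | cons a p ih =>
    obtain ⟨ha, hp⟩ := hp
    rcases List.mem_cons.1 he with rfl | he
    · exact Or.inl ha
    · rcases ih hp he with h | ⟨x, hx, h⟩
      · exact Or.inr ⟨a, by simp, h.symm⟩
      · exact Or.inr ⟨x, by simp [hx], h⟩

/-- A directed path between distinct vertices has an edge that ends in the final vertex. -/
theorem IsPath.exists_head_eq {u v : V} {p : List E} (hp : G.IsPath u p v) (huv : u ≠ v) :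
    ∃ x ∈ p, G.head x = v := by
  induction p generalizing u with
  | nil => exact absurd hp huv
  | cons a p ih =>
    obtain ⟨-, hp⟩ := hp
    by_cases h : G.head a = v
    · exact ⟨a, by simp, h⟩
    · obtain ⟨x, hx, hxv⟩ := ih hp h
      exact ⟨x, by simp [hx], hxv⟩

/-- A directed path that starts in `U` and ends outside `U` has an edge leaving `U`. -/
theorem IsPath.exists_leaving {u v : V} {p : List E} (hp : G.IsPath u p v) {U : Set V}
    (hu : u ∈ U) (hv : v ∉ U) : ∃ e ∈ p, G.tail e ∈ U ∧ G.head e ∉ U := by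
  induction p generalizing u with
  | nil => exact absurd (show u = v from hp) (fun h => hv (h ▸ hu))
  | cons a p ih =>
    obtain ⟨ha, hp⟩ := hp
    by_cases h : G.head a ∈ U
    · obtain ⟨x, hx, hxU⟩ := ih hp h
      exact ⟨x, by simp [hx], hxU⟩
    · exact ⟨a, by simp, ha ▸ hu, h⟩

open Classical in
/-- The number of edges in `S` that leave `U`. -/
noncomputable def numLeaving (G : DiMultigraph V E) (S : Finset E) (U : Set V) : ℕ :=
  ∑ e ∈ S, if G.tail e ∈ U ∧ G.head e ∉ U then 1 else 0

open Classical in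
/-- The number of indices `t` with `pos t ∈ U`. -/
noncomputable def numInside [Fintype T] (pos : T → V) (U : Set V) : ℕ :=
  ∑ t, if pos t ∈ U then 1 else 0

/-- Submodularity of the cut function; only edges between `U \ W` and `W \ U` make it strict. -/
theorem numLeaving_union_add_inter_le (S : Finset E) (U W : Set V) :
    G.numLeaving S (U ∪ W) + G.numLeaving S (U ∩ W) ≤
      G.numLeaving S U + G.numLeaving S W := by
  classical
  unfold numLeaving
  rw [← sum_add_distrib, ← sum_add_distrib]
  refine sum_le_sum fun e _ => ?_
  by_cases h₁ : G.tail e ∈ U <;> by_cases h₂ : G.tail e ∈ W <;> by_cases h₃ : G.head e ∈ U <;>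
    by_cases h₄ : G.head e ∈ W <;> simp [h₁, h₂, h₃, h₄]

theorem numInside_union_add_inter [Fintype T] (pos : T → V) (U W : Set V) :
    numInside pos (U ∪ W) + numInside pos (U ∩ W) = numInside pos U + numInside pos W := by
  classical
  unfold numInside
  rw [← sum_add_distrib, ← sum_add_distrib]
  refine sum_congr rfl fun t _ => ?_
  by_cases h₁ : pos t ∈ U <;> by_cases h₂ : pos t ∈ W <;> simp [h₁, h₂]

/-- If every set avoiding `r` has at least as many leaving edges as indices positioned in it, then
any index positioned at `u ≠ r` can be moved along some edge so that this remains true: the edge can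
be chosen to enter only sets with an excess of leaving edges. -/
theorem exists_edge_of_numInside_le [Fintype T] {S : Finset E} {pos : T → V} {r u : V}
    (H : ∀ U : Set V, r ∉ U → numInside pos U ≤ G.numLeaving S U) {t : T} (ht : pos t = u)
    (hu : u ≠ r) :
    ∃ e ∈ S, G.tail e = u ∧ ∀ U : Set V, r ∉ U → u ∉ U → G.head e ∈ U →
      numInside pos U < G.numLeaving S U := by
  classical
  by_contra! hcon
  -- If every edge out of `u` enters a tight set avoiding `u`, the union of these sets is again
  -- tight: leaving edges are submodular, positions modular, and `H` bounds the intersection.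
  have key : ∀ D : Finset E, D ⊆ S.filter (fun e => G.tail e = u) →
      ∃ W : Set V, r ∉ W ∧ u ∉ W ∧ (∀ e ∈ D, G.head e ∈ W) ∧
        G.numLeaving S W ≤ numInside pos W := by
    intro D
    induction D using Finset.induction_on with
    | empty => exact fun _ => ⟨∅, by simp [numLeaving, numInside]⟩
    | insert e D _ ih =>
      intro hD
      obtain ⟨heD, hDD⟩ := insert_subset_iff.1 hD
      obtain ⟨heS, heu⟩ := mem_filter.1 heD
      obtain ⟨W, hrW, huW, hW, htW⟩ := ih hDD
      obtain ⟨U, hrU, huU, hU, htU⟩ := hcon e heS heu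
      refine ⟨U ∪ W, by simp [hrU, hrW], by simp [huU, huW], ?_, ?_⟩
      · intro x hx
        rcases mem_insert.1 hx with rfl | hx
        · exact Or.inl hU
        · exact Or.inr (hW x hx)
      · have h₁ := numLeaving_union_add_inter_le (G := G) S U W
        have h₂ := numInside_union_add_inter pos U W
        have h₃ := H (U ∩ W) (fun h => hrU h.1)
        omega
  obtain ⟨W, hrW, huW, hW, htW⟩ := key _ Subset.rfl
  -- All edges of `S` out of `u` end in the tight set `W`, so adding `u` creates no leaving edge but
  -- gains the index `t`, against `H`.
  have h₁ : G.numLeaving S (insert u W) ≤ G.numLeaving S W := by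
    refine sum_le_sum fun e he => ?_
    by_cases hu' : G.tail e = u
    · simp [hW e (mem_filter.2 ⟨he, hu'⟩)]
    · by_cases h₂ : G.tail e ∈ W <;> by_cases h₃ : G.head e ∈ W <;> by_cases h₄ : G.head e = u <;>
        simp [h₂, h₃, h₄, hu', huW]
  have h₂ : numInside pos W < numInside pos (insert u W) := by
    refine sum_lt_sum (fun x _ => ?_) ⟨t, mem_univ t, by simp [ht, huW]⟩
    by_cases hx : pos x ∈ W <;> simp [hx]
  have h₃ := H (insert u W) (by simp [hrW, hu.symm])
  omega

/-- **Menger's theorem** for several starting points: if every set of vertices avoiding `r` is left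
by at least as many edges of `S` as there are starting points in it, then there are edge-disjoint
directed paths in `S` from all the starting points to `r`. -/
theorem exists_disjoint_paths [Fintype T] (S : Finset E) (pos : T → V) (r : V)
    (H : ∀ U : Set V, r ∉ U → numInside pos U ≤ G.numLeaving S U) :
    ∃ P : T → List E, (∀ t, G.IsPath (pos t) (P t) r) ∧ (∀ t, ∀ e ∈ P t, e ∈ S) ∧
      ∀ t t' e, e ∈ P t → e ∈ P t' → t = t' := by
  classical
  induction S using Finset.strongInduction generalizing pos with
  | H S ih =>
  by_cases hall : ∀ t, pos t = r
  · exact ⟨fun _ => [], fun t => hall t, by simp, by simp⟩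
  push Not at hall
  obtain ⟨t, ht⟩ := hall
  obtain ⟨e, heS, heu, hlt⟩ := exists_edge_of_numInside_le H rfl ht
  obtain ⟨P, hP, hPS, hdisj⟩ := ih (S.erase e) (erase_ssubset heS)
    (Function.update pos t (G.head e)) (by
      -- Moving `t` along `e` and deleting `e` costs both sides one if `e` leaves `U`; if `e` enters
      -- `U`, the strict inequality `hlt` absorbs the extra index; otherwise nothing changes.
      intro U hr
      have h₁ : numInside pos U =
          (if pos t ∈ U then 1 else 0) + ∑ x ∈ univ.erase t, if pos x ∈ U then 1 else 0 :=
        (add_sum_erase univ (fun x => if pos x ∈ U then 1 else 0) (mem_univ t)).symm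
      have h₂ : numInside (Function.update pos t (G.head e)) U =
          (if G.head e ∈ U then 1 else 0) + ∑ x ∈ univ.erase t, if pos x ∈ U then 1 else 0 := by
        refine (add_sum_erase univ (fun x => if Function.update pos t (G.head e) x ∈ U then 1 else 0)
          (mem_univ t)).symm.trans ?_
        rw [Function.update_self]
        congr 1
        refine sum_congr rfl fun x hx => ?_
        rw [Function.update_of_ne (ne_of_mem_erase hx)]
      have h₃ : G.numLeaving S U =
          (if G.tail e ∈ U ∧ G.head e ∉ U then 1 else 0) + G.numLeaving (S.erase e) U :=
        (add_sum_erase S (fun x => if G.tail x ∈ U ∧ G.head x ∉ U then 1 else 0) heS).symm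
      have h₄ := H U hr
      have h₅ := hlt U hr
      rw [heu] at h₃
      by_cases ht : pos t ∈ U <;> by_cases hh : G.head e ∈ U <;>
        simp only [ht, hh, not_true, not_false_eq_true, and_true, and_false, if_true,
          if_false, forall_true_left] at h₁ h₂ h₃ h₅ <;> omega)
  have hne : ∀ x, e ∉ P x := fun x hx => notMem_erase e S (hPS x e hx)
  have hmem : ∀ x a, a ∈ Function.update P t (e :: P t) x → a ∈ P x ∨ (x = t ∧ a = e) := by
    intro x a ha
    by_cases hx : x = t
    · subst hx
      rw [Function.update_self, List.mem_cons] at ha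
      exact ha.symm.imp_right fun h => ⟨rfl, h⟩
    · rw [Function.update_of_ne hx] at ha
      exact Or.inl ha
  refine ⟨Function.update P t (e :: P t), fun x => ?_, fun x a ha => ?_, fun x y a hx hy => ?_⟩
  · have := hP x
    by_cases hx : x = t
    · subst hx
      rw [Function.update_self] at this ⊢
      exact ⟨heu, this⟩
    · rw [Function.update_of_ne hx] at this ⊢
      exact this
  · rcases hmem x a ha with h | ⟨-, rfl⟩
    · exact mem_of_mem_erase (hPS x a h)
    · exact heS
  · rcases hmem x a hx with h | ⟨rfl, rfl⟩ <;> rcases hmem y a hy with h' | ⟨rfl, h'⟩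
    · exact hdisj x y a h h'
    · exact absurd (h' ▸ h) (hne x)
    · exact absurd h' (hne y)
    · rfl

/-- The multigraph in which every edge is replaced by `n` parallel copies. -/
def copies (G : DiMultigraph V E) (n : ℕ) : DiMultigraph V (E × Fin n) where
  tail e := G.tail e.1
  head e := G.head e.1

end DiMultigraph

/-! ### Existence and positivity of cuts. -/

namespace Network

variable {V E A : Type*} {s : ℕ} (N : Network V E s)

theorem separated_univ [Fintype E] : N.separated Finset.univ = Set.univ := by
  refine Set.eq_univ_of_forall fun i p hp => ?_
  obtain ⟨x, hx, -⟩ := hp.exists_head_eq (N.receiver_not_source i)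
  exact ⟨x, hx, mem_univ x⟩

/-- A network has at least one source. -/
theorem sources_pos {V E : Type*} [Finite E] {s : ℕ} (N : Network V E s) : 0 < s := by
  by_contra hs
  have hs : s = 0 := by omega
  subst hs
  have hin : ∀ v, ∃ e, N.graph.head e = v := by
    intro v
    by_contra! h
    obtain ⟨i, -⟩ := N.source_of_no_inEdge v h
    exact i.elim0
  obtain ⟨e₀, -⟩ := hin N.receiver
  -- With no sources every edge has a predecessor, an infinite backward descent.
  refine N.acyclic.wellFounded.induction (C := fun _ => False) e₀ fun e ih => ?_
  obtain ⟨e', he'⟩ := hin (N.graph.tail e)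
  exact ih e' he'

theorem exists_isCut [Finite E] : ∃ C, N.IsCut C := by
  classical
  let _ := Fintype.ofFinite E
  exact ⟨Finset.univ, ⟨0, N.sources_pos⟩, by simp [separated_univ]⟩

variable {N}

theorem IsCut.card_pos {C : Finset E} (hC : N.IsCut C) : 0 < C.card := by
  obtain ⟨i, hi⟩ := hC
  obtain ⟨p, hp⟩ := N.path_to_receiver (N.source i)
  obtain ⟨e, -, he⟩ := hi p hp
  exact Finset.card_pos.2 ⟨e, he⟩

/-- Makes `|I_C|` a legitimate denominator and a legitimate block length `n`. -/
theorem IsCut.ncard_separated_pos {C : Finset E} (hC : N.IsCut C) :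
    0 < (N.separated C).ncard :=
  (Set.ncard_pos (Set.toFinite _)).2 hC

/-! ### The cut-set bound. -/

/-- If two message generators agree on the sources that `C` does not separate from the receiver, and
the vectors carried on `C` agree, then so do the vectors carried on every edge from whose head there
is a path to the receiver that avoids `C`. -/
theorem carried_congr_of_cut [Finite E] {B : Type*} {k n : ℕ} (c : Code N A B k n) (C : Finset E)
    {α β : Fin s → Fin k → A} (hαβ : ∀ i, i ∉ N.separated C → α i = β i)
    (hC : ∀ e ∈ C, c.carried α e = c.carried β e) (e : E) (p : List E)
    (hp : N.graph.IsPath (N.graph.head e) p N.receiver) (hpC : ∀ x ∈ p, x ∉ C) :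
    c.carried α e = c.carried β e := by
  induction e using N.acyclic.wellFounded.induction generalizing p with
  | _ e ih =>
  by_cases he : e ∈ C
  · exact hC e he
  have hp' : N.graph.IsPath (N.graph.tail e) (e :: p) N.receiver := ⟨rfl, hp⟩
  have hpC' : ∀ x ∈ e :: p, x ∉ C := by
    intro x hx
    rcases List.mem_cons.1 hx with rfl | hx
    · exact he
    · exact hpC x hx
  rw [Code.carried_eq, Code.carried_eq]
  congr 1
  · funext e'
    exact ih e'.1 e'.2 (e :: p) (by rwa [e'.2]) hpC'
  · funext i
    -- A source at the tail of `e` reaches the receiver through `e :: p`, which avoids `C`, so it is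
    -- not separated.
    refine hαβ i.1 fun hi => ?_
    obtain ⟨x, hx, hxC⟩ := hi (e :: p) (by rwa [i.2])
    exact hpC' x hx hxC

/-- The cut-set bound for the identity target function. -/
theorem mul_ncard_separated_le [Finite E] [Finite A] (hA : 2 ≤ Nat.card A) {k n : ℕ}
    {c : Code N A (Fin s → A) k n} (hc : c.IsSolution (identityTarget A s)) (C : Finset E) :
    k * (N.separated C).ncard ≤ n * C.card := by
  classical
  have : Nonempty A := (Nat.card_pos_iff.1 (by omega)).1
  let a₀ : A := Classical.arbitrary A
  -- Unseparated sources are frozen at `a₀`, so that only separated messages vary.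
  let ext : (N.separated C → Fin k → A) → Fin s → Fin k → A := fun a i =>
    if h : i ∈ N.separated C then a ⟨i, h⟩ else fun _ => a₀
  have hinj : Function.Injective
      (fun (a : N.separated C → Fin k → A) (e : C) => c.carried (ext a) e.1) := by
    intro a b hab
    have hcar : ∀ e : N.graph.InEdge N.receiver, c.carried (ext a) e.1 = c.carried (ext b) e.1 := by
      intro e
      refine carried_congr_of_cut c C (fun i hi => ?_) (fun x hx => congrFun hab ⟨x, hx⟩) e.1 []
        e.2 (by simp)
      simp [ext, hi]
    funext i j
    have h := hc (ext a) j
    rw [funext hcar, hc (ext b) j] at h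
    have h' := congrFun h i.1
    simpa [identityTarget, ext] using h'.symm
  have hle := Nat.card_le_card_of_injective _ hinj
  simp only [Nat.card_fun, Nat.card_eq_fintype_card (α := Fin _), Fintype.card_fin,
    Nat.card_eq_fintype_card (α := C), Fintype.card_coe, Nat.card_coe_set_eq, ← pow_mul] at hle
  exact (Nat.pow_le_pow_iff_right (by omega)).1 hle

/-! ### Routing along edge-disjoint paths. -/

/-- If all cuts allow it, the messages can be routed to the receiver along edge-disjoint paths. -/
theorem exists_routing [Finite E] {k n : ℕ}
    (H : ∀ C, N.IsCut C → k * (N.separated C).ncard ≤ n * C.card) :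
    ∃ P : Fin s × Fin k → List (E × Fin n),
      (∀ t, (N.graph.copies n).IsPath (N.source t.1) (P t) N.receiver) ∧
      ∀ t t' e, e ∈ P t → e ∈ P t' → t = t' := by
  classical
  let _ := Fintype.ofFinite E
  obtain ⟨P, hP, -, hdisj⟩ := (DiMultigraph.exists_disjoint_paths (G := N.graph.copies n)
    Finset.univ (fun t : Fin s × Fin k => N.source t.1) N.receiver (by
      intro U hU
      -- The edges leaving `U` separate every source in `U`, perhaps others too; hence only `I ⊆
      -- I_C`. If `U` has no source, `C` need not be a cut, but the demand is zero.
      let C : Finset E := {e | N.graph.tail e ∈ U ∧ N.graph.head e ∉ U}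
      let I : Finset (Fin s) := {i | N.source i ∈ U}
      have hI : (I : Set (Fin s)) ⊆ N.separated C := by
        intro i hi p hp
        obtain ⟨e, he, heU⟩ := hp.exists_leaving (U := U) (by simpa [I] using hi) hU
        exact ⟨e, he, by simpa [C] using heU⟩
      have hin : DiMultigraph.numInside (fun t : Fin s × Fin k => N.source t.1) U = k * I.card := by
        simp only [DiMultigraph.numInside]
        rw [← Finset.card_filter]
        have : (Finset.univ.filter fun t : Fin s × Fin k => N.source t.1 ∈ U) =
            I ×ˢ (Finset.univ : Finset (Fin k)) := by
          ext t; simp [I]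
        rw [this, card_product, card_univ, Fintype.card_fin, mul_comm]
      have hout : (N.graph.copies n).numLeaving Finset.univ U = n * C.card := by
        simp only [DiMultigraph.numLeaving]
        rw [← Finset.card_filter]
        have : (Finset.univ.filter fun e : E × Fin n =>
            (N.graph.copies n).tail e ∈ U ∧ (N.graph.copies n).head e ∉ U) =
            C ×ˢ (Finset.univ : Finset (Fin n)) := by
          ext e
          simp only [mem_filter, mem_product, mem_univ, true_and, and_true, C]
          rfl
        rw [this, card_product, card_univ, Fintype.card_fin, mul_comm]
      rw [hin, hout]
      rcases I.eq_empty_or_nonempty with h | ⟨i, hi⟩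
      · simp [h]
      · refine le_trans (Nat.mul_le_mul_left k ?_) (H C ⟨i, hI hi⟩)
        rw [← Set.ncard_coe_finset]
        exact Set.ncard_le_ncard hI (Set.toFinite _)))
  exact ⟨P, hP, hdisj⟩

/-- Edge-disjoint paths carrying the messages give a solution for the identity target function. -/
theorem exists_solution_of_routing [Finite E] [Nonempty A] {k n : ℕ}
    (P : Fin s × Fin k → List (E × Fin n))
    (hP : ∀ t, (N.graph.copies n).IsPath (N.source t.1) (P t) N.receiver)
    (hdisj : ∀ t t' e, e ∈ P t → e ∈ P t' → t = t') :
    ∃ c : Code N A (Fin s → A) k n, c.IsSolution (identityTarget A s) := by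
  classical
  let a₀ : A := Classical.arbitrary A
  have hlast : ∀ t, ∃ x ∈ P t, N.graph.head x.1 = N.receiver := fun t =>
    (hP t).exists_head_eq (N.receiver_not_source t.1)
  choose last hlastP hlast using hlast
  -- The copy `(e, j)` is component `j` of the vector on `e`. On the path of `t` it forwards the
  -- symbol of an edge of that path ending at the tail of `e`, or else the message `t` itself. The
  -- value `a₀` only fills copies on no path.
  let enc (e : E) (z : N.graph.InEdge (N.graph.tail e) → Fin n → A)
      (m : {i : Fin s // N.source i = N.graph.tail e} → Fin k → A) (j : Fin n) : A :=
    if h : ∃ t, (e, j) ∈ P t then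
      if h' : ∃ x ∈ P h.choose, N.graph.head x.1 = N.graph.tail e then
        z ⟨h'.choose.1, h'.choose_spec.2⟩ h'.choose.2
      else if h' : N.source h.choose.1 = N.graph.tail e then m ⟨h.choose.1, h'⟩ h.choose.2
      else a₀
    else a₀
  let c : Code N A (Fin s → A) k n :=
    { encode := enc
      decode := fun z j i => z ⟨(last (i, j)).1, hlast (i, j)⟩ (last (i, j)).2 }
  refine ⟨c, fun α => ?_⟩
  have key : ∀ e j t, (e, j) ∈ P t → c.carried α e j = α t.1 t.2 := by
    intro e
    induction e using N.acyclic.wellFounded.induction with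
    | _ e ih =>
    intro j t ht
    have h : ∃ t, (e, j) ∈ P t := ⟨t, ht⟩
    -- Disjointness: the encoder's choice of path is forced.
    have hch : h.choose = t := hdisj _ _ _ h.choose_spec ht
    rw [Code.carried_eq]
    change enc e (fun e' => c.carried α e'.1) (fun i => α i.1) j = α t.1 t.2
    simp only [enc]
    rw [dif_pos h]
    split_ifs with h₁ h₂
    · exact hch ▸ ih h₁.choose.1 h₁.choose_spec.2 h₁.choose.2 h.choose h₁.choose_spec.1
    · rw [hch]
    · exfalso
      rcases (hP t).tail_eq_or_exists_head_eq ht with h₃ | h₃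
      · exact h₂ (hch ▸ h₃.symm)
      · exact h₁ (hch ▸ h₃)
  intro j
  funext i
  exact key _ _ (i, j) (hlastP (i, j))

end Network

/-! ### Footprints of the identity and equality of the minima. -/

/-- Only equal assignments are interchangeable in the identity function. -/
theorem footprintSize_identityTarget {A : Type*} [Nonempty A] {s : ℕ} (I : Set (Fin s)) :
    footprintSize (identityTarget A s) I = Nat.card A ^ I.ncard := by
  classical
  have hbot : footprintSetoid (identityTarget A s) I = ⊥ := by
    ext a b
    refine ⟨fun h => ?_, fun h => ?_⟩
    · let ext (a : I → A) : Fin s → A := fun i =>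
        if h : i ∈ I then a ⟨i, h⟩ else Classical.arbitrary A
      have hext := h (ext a) (ext b) (fun i => by simp [ext]) (fun i => by simp [ext])
        (fun j hj => by simp [ext, hj])
      funext i
      simpa [ext, identityTarget] using congrFun hext i.1
    · obtain rfl : a = b := h
      exact (footprintSetoid (identityTarget A s) I).refl a
  rw [footprintSize, hbot, Nat.card_congr Setoid.quotientBotEquiv, Nat.card_fun,
    Nat.card_coe_set_eq]

theorem Network.targetCutRatios_identityTarget {V E A : Type*} [Finite A] (hA : 2 ≤ Nat.card A)
    {s : ℕ} (N : Network V E s) : N.targetCutRatios (identityTarget A s) = N.cutRatios := by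
  have : Nonempty A := (Nat.card_pos_iff.1 (by omega)).1
  have hA' : (1 : ℝ) < Nat.card A := by exact_mod_cast hA
  have h : ∀ I : Set (Fin s),
      Real.logb (Nat.card A) (footprintSize (identityTarget A s) I) = I.ncard := by
    intro I
    rw [footprintSize_identityTarget, Nat.cast_pow, Real.logb_pow, Real.logb_self_eq_one hA',
      mul_one]
  simp only [targetCutRatios, cutRatios, h]

/-- The smallest cut ratio is attained by a code that routes the messages. -/
theorem Network.exists_isLeast_cutRatios_isGreatest_achievableRates {V E A : Type*} [Finite E]
    [Finite A] (hA : 2 ≤ Nat.card A) {s : ℕ} (N : Network V E s) :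
    ∃ r, IsLeast N.cutRatios r ∧ IsGreatest (N.achievableRates (identityTarget A s)) r := by
  have : Nonempty A := (Nat.card_pos_iff.1 (by omega)).1
  obtain ⟨C, hC, hmin⟩ := Set.exists_min_image {C | N.IsCut C}
    (fun C : Finset E => (C.card : ℝ) / ((N.separated C).ncard : ℝ)) (Set.toFinite _) N.exists_isCut
  have hpos : ∀ D, N.IsCut D → (0 : ℝ) < (N.separated D).ncard := fun D hD => by
    exact_mod_cast hD.ncard_separated_pos
  -- With `k = |C|` and `n = |I_C|` the rate equals the minimal ratio, and minimality
  -- cross-multiplied is the hypothesis of `exists_routing`.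
  refine ⟨_, ⟨⟨C, hC, rfl⟩, ?_⟩, ⟨C.card, (N.separated C).ncard, hC.card_pos,
    hC.ncard_separated_pos, rfl, ?_⟩, ?_⟩
  · rintro _ ⟨D, hD, rfl⟩
    exact hmin D hD
  · obtain ⟨P, hP, hdisj⟩ := N.exists_routing (k := C.card) (n := (N.separated C).ncard) (by
      intro D hD
      have h := hmin D hD
      rw [div_le_div_iff₀ (hpos C hC) (hpos D hD)] at h
      rw [mul_comm _ D.card]
      exact_mod_cast h)
    exact exists_solution_of_routing P hP hdisj
  · rintro _ ⟨k, n, -, hn, rfl, c, hc⟩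
    have h := mul_ncard_separated_le hA hc C
    rw [div_le_div_iff₀ (by exact_mod_cast hn) (hpos C hC), mul_comm (C.card : ℝ)]
    exact_mod_cast h

end NetComp

/-- For the identity target function, the computing capacity, the min-cut with respect to the target
function, and the min-cut of the network coincide. The first three conjuncts say that the supremum
and the two minima that define these numbers are a genuine supremum and genuine minima. -/
theorem theorem3p1 {V E A : Type*} [Finite V] [Finite E] [Finite A] (hA : 2 ≤ Nat.card A)
    {s : ℕ} (N : NetComp.Network V E s) :
    IsLUB (N.achievableRates (NetComp.identityTarget A s))
        (N.computingCapacity (NetComp.identityTarget A s)) ∧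
      IsLeast (N.targetCutRatios (NetComp.identityTarget A s))
        (N.targetMinCut (NetComp.identityTarget A s)) ∧
      IsLeast N.cutRatios N.minCut ∧
      N.computingCapacity (NetComp.identityTarget A s) =
        N.targetMinCut (NetComp.identityTarget A s) ∧
      N.targetMinCut (NetComp.identityTarget A s) = N.minCut := by
  obtain ⟨r, hr, hr'⟩ :=
    N.exists_isLeast_cutRatios_isGreatest_achievableRates (A := A) hA
  have hcap : N.computingCapacity (NetComp.identityTarget A s) = r := hr'.csSup_eq
  have hcut : N.minCut = r := hr.csInf_eq
  have hset := N.targetCutRatios_identityTarget hA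
  have htarget : N.targetMinCut (NetComp.identityTarget A s) = r := by
    rw [NetComp.Network.targetMinCut, hset, hr.csInf_eq]
  rw [hcap, htarget, hcut, hset]
  exact ⟨hr'.isLUB, hr, hr, rfl, rfl⟩
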